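/- Let $\mathcal A$ be a Grothendieck category, with $\mathrm{Ext}$ groups $\mathrm{Ext}^i$ ($i\ge 0$). For an object $X$ write $\mathrm{projdim}\,X\le m$ if $\mathrm{Ext}^i(X,-)=0$ for all $i\ge m+1$ and $\mathrm{injdim}\,X\le m$ if $\mathrm{Ext}^i(-,X)=0$ for all $i\ge m+1$. Let $FPD(\mathcal A)$ (resp. $FID(\mathcal A)$) be the supremum of $\mathrm{projdim}\,X$ (resp. $\mathrm{injdim}\,X$) over all $X$ for which it is finite. $\mathcal A$ is a Gorenstein category if (1) for every object $X$, $\mathrm{projdim}\,X<\infty$ if and only if $\mathrm{injdim}\,X<\infty$; (2) $FPD(\mathcal A)<\infty$ and $FID(\mathcal A)<\infty$; (3) $\mathcal A$ has a generator of finite projective dimension. It has dimension at most $n$ if moreover $FPD(\mathcal A)\le n$ and $FID(\mathcal A)\le n$. Let $\mathcal L$ be the class of objects of finite projective dimension. For a class $\mathcal C$ of objects let $\mathcal C^{\perp}=\{Y:\mathrm{Ext}^1(C,Y)=0\ \forall C\in\mathcal C\}$ and ${}^{\perp}\mathcal C=\{X:\mathrm{Ext}^1(X,C)=0\ \forall C\in\mathcal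 C\}$. An object $C$ is an $n$-th syzygy of $X$ if there is an exact sequence $0\to C\to P_{n-1}\to\cdots\to P_0\to X\to 0$ with all $P_i$ projective ($C\cong X$ if $n=0$). An object $C$ is Gorenstein projective if there is an exact complex $P=(\cdots\to P^{-1}\to P^0\to P^1\to\cdots)$ of projective objects such that $\mathrm{Hom}(P,Q)$ is exact for every projective $Q$ and $C\cong\ker(P^0\to P^1)$. $\mathrm{Gpd}(X)$ is the least $m\ge 0$ such that some $m$-th syzygy of $X$ is Gorenstein projective ($\infty$ if there is none), and $glGpd(\mathcal A)=\sup_X \mathrm{Gpd}(X)$. A pair $(\mathcal F,\mathcal C)$ of classes of objects is a cotorsion pair if $\mathcal F^{\perp}=\mathcal C$ and ${}^{\perp}\mathcal C=\mathcal F$; it is complete if for all objects $X,Y$ there are exact sequences $0\to C\to F\to X\to 0$ and $0\to Y\to C'\to F'\to 0$ with $F,F'\in\mathcal F$ and $C,C'\in\mathcal C$; it is hereditary if $\mathcal F$ is closed under kernels of epimorphisms between its objects, $\mathcal C$ is closed under cokernels of monomorphisms between its objects, and $\mathrm{Ext}^i(F,C)=0$ for all $F\in\mathcal F$, $C\in\mathcal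 C$, $i\ge 1$. Theorem. Let $n\ge 0$ and let $\mathcal A$ be a Grothendieck category with enough projectives that is a Gorenstein category of dimension at most $n$. For every object $C$ of $\mathcal A$ the following are equivalent: 1. $C$ is an $n$-th syzygy (of some object); 2. $C\in{}^{\perp}\mathcal L$; 3. $C$ is Gorenstein projective. Moreover $glGpd(\mathcal A)\le n$, and $({}^{\perp}\mathcal L,\mathcal L)$ is a complete hereditary cotorsion pair. -/

import Mathlib

open CategoryTheory CategoryTheory.Limits CategoryTheory.Abelian

universe w v u

namespace GorensteinCat

/-- The class of objects of finite projective dimension, where `projdim X ≤ n` means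
`Ext^i(X, -) = 0` for all `i ≥ n + 1`. -/
def finiteProjDim (A : Type u) [Category.{v} A] [Abelian A] : ObjectProperty A :=
  fun X => projectiveDimension X < ⊤

/-- The class of objects of finite injective dimension. -/
def finiteInjDim (A : Type u) [Category.{v} A] [Abelian A] : ObjectProperty A :=
  fun X => injectiveDimension X < ⊤

/-- The finitistic projective dimension `FPD(A)`: the supremum of `projdim X` over all `X` with
`projdim X < ∞`. -/
noncomputable def FPD (A : Type u) [Category.{v} A] [Abelian A] : WithBot ℕ∞ :=
  ⨆ (X : A) (_ : finiteProjDim A X), projectiveDimension X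

/-- The finitistic injective dimension `FID(A)`. -/
noncomputable def FID (A : Type u) [Category.{v} A] [Abelian A] : WithBot ℕ∞ :=
  ⨆ (X : A) (_ : finiteInjDim A X), injectiveDimension X

/-- Gorenstein categories (to be used for Grothendieck categories `A`, where a generator is the
same thing as a separator). -/
structure IsGorenstein (A : Type u) [Category.{v} A] [Abelian A] : Prop where
  finiteProjDim_iff : ∀ X : A, finiteProjDim A X ↔ finiteInjDim A X
  FPD_lt_top : FPD A < ⊤
  FID_lt_top : FID A < ⊤
  exists_generator : ∃ G : A, IsSeparator G ∧ finiteProjDim A G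

/-- A Gorenstein category of dimension at most `n`. -/
structure IsGorensteinOfDimLE (A : Type u) [Category.{v} A] [Abelian A] (n : ℕ) : Prop
    extends IsGorenstein A where
  FPD_le : FPD A ≤ n
  FID_le : FID A ≤ n

/-- `IsSyzygyOf n X C`: the object `C` is an `n`-th syzygy of `X`, that is, there is an exact
sequence `0 → C → P_{n-1} → ⋯ → P_0 → X → 0` with all `P_i` projective (for `n = 0`: `C ≅ X`).
It is obtained by splicing short exact sequences. -/
def IsSyzygyOf {A : Type u} [Category.{v} A] [Abelian A] : ℕ → A → A → Prop
  | 0, X, C => Nonempty (C ≅ X)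
  | n + 1, X, C => ∃ (K P : A) (i : K ⟶ P) (p : P ⟶ X) (h : i ≫ p = 0),
      (ShortComplex.mk i p h).ShortExact ∧ Projective P ∧ IsSyzygyOf n K C

/-- `C` is an `n`-th syzygy (of some object). -/
def IsSyzygy {A : Type u} [Category.{v} A] [Abelian A] (n : ℕ) (C : A) : Prop :=
  ∃ X : A, IsSyzygyOf n X C

/-- A complex `⋯ → P^{-1} → P^0 → P^1 → ⋯` is a complete projective resolution of `C` if it is
an exact complex of projective objects, the complex `Hom(P, Q)` is exact for every
projective object `Q`, and `C` is the kernel of `P^0 → P^1`. -/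
structure IsCompleteProjectiveResolution {A : Type u} [Category.{v} A] [Abelian A]
    (P : CochainComplex A ℤ) (C : A) : Prop where
  projective : ∀ i : ℤ, Projective (P.X i)
  exact : P.Acyclic
  /-- Exactness of `Hom(P^{i+2}, Q) → Hom(P^{i+1}, Q) → Hom(P^i, Q)` in the middle. -/
  hom_exact : ∀ Q : A, Projective Q → ∀ (i : ℤ) (f : P.X (i + 1) ⟶ Q),
    P.d i (i + 1) ≫ f = 0 → ∃ g : P.X (i + 1 + 1) ⟶ Q, P.d (i + 1) (i + 1 + 1) ≫ g = f
  kernel_iso : Nonempty (C ≅ kernel (P.d 0 1))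

/-- Gorenstein projective objects. -/
def gorensteinProjective (A : Type u) [Category.{v} A] [Abelian A] : ObjectProperty A :=
  fun C => ∃ P : CochainComplex A ℤ, IsCompleteProjectiveResolution P C

/-- The Gorenstein projective dimension of `X`: the least `m` such that an `m`-th syzygy of `X`
is Gorenstein projective, and `⊤` if there is no such `m`. -/
noncomputable def Gpd {A : Type u} [Category.{v} A] [Abelian A] (X : A) : ℕ∞ :=
  sInf {d : ℕ∞ | ∃ m : ℕ, d = m ∧ ∃ K : A, IsSyzygyOf m X K ∧ gorensteinProjective A K}

/-- The global Gorenstein projective dimension. -/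
noncomputable def glGpd (A : Type u) [Category.{v} A] [Abelian A] : ℕ∞ :=
  ⨆ X : A, Gpd X

/-- The class `𝒞^⊥` of all `Y` with `Ext^1(X, Y) = 0` for all `X` in `𝒞`. -/
def rightPerp {A : Type u} [Category.{v} A] [Abelian A] [HasExt.{w} A]
    (𝒞 : ObjectProperty A) : ObjectProperty A :=
  fun Y => ∀ X : A, 𝒞 X → Subsingleton (Ext.{w} X Y 1)

/-- The class `^⊥𝒞` of all `X` with `Ext^1(X, Y) = 0` for all `Y` in `𝒞`. -/
def leftPerp {A : Type u} [Category.{v} A] [Abelian A] [HasExt.{w} A]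
    (𝒞 : ObjectProperty A) : ObjectProperty A :=
  fun X => ∀ Y : A, 𝒞 Y → Subsingleton (Ext.{w} X Y 1)

/-- `(ℱ, 𝒞)` is a cotorsion pair: `ℱ^⊥ = 𝒞` and `^⊥𝒞 = ℱ`. -/
structure IsCotorsionPair {A : Type u} [Category.{v} A] [Abelian A] [HasExt.{w} A]
    (ℱ 𝒞 : ObjectProperty A) : Prop where
  rightPerp_eq : rightPerp.{w} ℱ = 𝒞
  leftPerp_eq : leftPerp.{w} 𝒞 = ℱ

/-- Completeness of a pair `(ℱ, 𝒞)`: for all `X` and `Y` there are exact sequences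
`0 → C → F → X → 0` and `0 → Y → C' → F' → 0` with `F, F'` in `ℱ` and `C, C'` in `𝒞`. -/
structure IsCompletePair {A : Type u} [Category.{v} A] [Abelian A]
    (ℱ 𝒞 : ObjectProperty A) : Prop where
  exists_left : ∀ X : A, ∃ (C F : A) (i : C ⟶ F) (p : F ⟶ X) (h : i ≫ p = 0),
    (ShortComplex.mk i p h).ShortExact ∧ ℱ F ∧ 𝒞 C
  exists_right : ∀ Y : A, ∃ (C F : A) (i : Y ⟶ C) (p : C ⟶ F) (h : i ≫ p = 0),
    (ShortComplex.mk i p h).ShortExact ∧ ℱ F ∧ 𝒞 C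

/-- A cotorsion pair `(ℱ, 𝒞)` is hereditary if `ℱ` is closed under kernels of epimorphisms,
`𝒞` is closed under cokernels of monomorphisms, and `Ext^i(F, C) = 0` for all `i ≥ 1`, `F` in `ℱ`
and `C` in `𝒞`. (For a cotorsion pair in an abelian category with enough projectives and enough
injectives each of these conditions implies the others; all of them are recorded.) -/
structure IsHereditaryPair {A : Type u} [Category.{v} A] [Abelian A] [HasExt.{w} A]
    (ℱ 𝒞 : ObjectProperty A) : Prop where
  left_closed : ∀ S : ShortComplex A, S.ShortExact → ℱ S.X₂ → ℱ S.X₃ → ℱ S.X₁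
  right_closed : ∀ S : ShortComplex A, S.ShortExact → 𝒞 S.X₁ → 𝒞 S.X₂ → 𝒞 S.X₃
  ext_eq_zero : ∀ F C : A, ℱ F → 𝒞 C → ∀ i : ℕ, 1 ≤ i → Subsingleton (Ext.{w} F C i)

end GorensteinCat

/-! Everything rests on two features of an `n`-th syzygy `C` of `X`. If `L` has finite projective
dimension, then its injective dimension is at most `n`, so dimension shifting from `X` kills all
positive Ext from `C` to `L` (`ext_subsingleton_of_isSyzygy`). If `X` embeds in an injective `I`,
then `I` has projective dimension at most `n`, so its `n`-th syzygies are projective, and the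
horseshoe construction embeds `C` in a projective with cokernel again an `n`-th syzygy
(`exists_projective_embedding`).

Climbing back from `C` to `X` by pushouts yields `0 → X → L → G → 0` with `L` of finite projective
dimension and `G` an `n`-th syzygy (`exists_right_approximation`). When `X` lies in the left
perpendicular class, so does `L`, which is then projective; iteration exhibits `X` as an `n`-th
syzygy. Splicing projective embeddings with projective covers gives complete resolutions.
Conversely, a kernel in an exact complex of projectives is an `n`-th syzygy of the kernel `n` places
to its right. -/

namespace GorensteinCat

/-! ### Short exact sequences: pushouts, quotients, horseshoe -/

variable {A : Type u} [Category.{v} A] [Abelian A]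

/-- There is a short exact sequence `0 → X → Y → Z → 0`. -/
def IsExtension (X Y Z : A) : Prop :=
  ∃ (i : X ⟶ Y) (p : Y ⟶ Z) (h : i ≫ p = 0), (ShortComplex.mk i p h).ShortExact

lemma isExtension_of_iso_left {X X' Y Z : A} (e : X' ≅ X) (h : IsExtension X Y Z) :
    IsExtension X' Y Z := by
  obtain ⟨i, p, w, hS⟩ := h
  let α : ShortComplex.mk i p w ≅ ShortComplex.mk (e.hom ≫ i) p (by simp [w]) :=
    ShortComplex.isoMk e.symm (Iso.refl _) (Iso.refl _) (by simp) (by simp)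
  exact ⟨_, _, _, ShortComplex.shortExact_of_iso α hS⟩

lemma isExtension_of_mono {X Y : A} (i : X ⟶ Y) [Mono i] :
    IsExtension X Y (cokernel i) :=
  ⟨i, cokernel.π i, cokernel.condition i, .mk' (ShortComplex.exact_cokernel i) ‹_› inferInstance⟩

lemma isExtension_of_epi {X Y : A} (p : X ⟶ Y) [Epi p] :
    IsExtension (kernel p) X Y :=
  ⟨kernel.ι p, p, kernel.condition p, .mk' (ShortComplex.exact_kernel p) inferInstance ‹_›⟩

lemma exists_isExtension_of_enoughProjectives [EnoughProjectives A] (X : A) :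
    ∃ K P : A, Projective P ∧ IsExtension K P X :=
  ⟨_, _, inferInstance, isExtension_of_epi (Projective.π X)⟩

lemma exists_isExtension_of_enoughInjectives [EnoughInjectives A] (X : A) :
    ∃ I Z : A, Injective I ∧ IsExtension X I Z :=
  ⟨_, _, inferInstance, isExtension_of_mono (Injective.ι X)⟩

lemma isExtension_of_isPushout {K P Y L E : A} {i : K ⟶ P} {p : P ⟶ Y} {w : i ≫ p = 0}
    (hS : (ShortComplex.mk i p w).ShortExact) {f : K ⟶ L} {a : P ⟶ E} {b : L ⟶ E}
    (sq : IsPushout i f a b) : IsExtension L E Y := by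
  have : Mono i := hS.mono_f
  have : Epi p := hS.epi_g
  have hw : i ≫ p = f ≫ 0 := by rw [w, comp_zero]
  have : Epi (sq.desc p 0 hw) := epi_of_epi_fac (sq.inl_desc p 0 hw)
  have : Mono b := Abelian.mono_inr_of_isColimit i f sq.isColimit
  refine ⟨b, sq.desc p 0 hw, sq.inr_desc _ _ _, .mk' ?_ ‹_› ‹_›⟩
  · refine ShortComplex.exact_of_g_is_cokernel _ (CokernelCofork.IsColimit.ofπ' _ _ ?_)
    intro T s hs
    dsimp at s hs ⊢
    have hs' : i ≫ a ≫ s = 0 := by rw [sq.w_assoc, hs, comp_zero]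
    refine ⟨hS.exact.desc (a ≫ s) hs', ?_⟩
    apply sq.hom_ext
    · rw [sq.inl_desc_assoc]
      exact hS.exact.g_desc _ _
    · rw [sq.inr_desc_assoc, zero_comp, hs]

lemma IsExtension.exists_pushout {K P Y L G : A} (h₁ : IsExtension K P Y)
    (h₂ : IsExtension K L G) : ∃ E : A, IsExtension L E Y ∧ IsExtension P E G := by
  obtain ⟨i, p, w, hS⟩ := h₁
  obtain ⟨j, q, w', hT⟩ := h₂
  have sq := IsPushout.of_hasPushout i j
  exact ⟨pushout i j, isExtension_of_isPushout hS sq, isExtension_of_isPushout hT sq.flip⟩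

/-- This is the third isomorphism theorem for `L ⊆ E ⊆ Q`: `D` plays the role of `Q/L`, realised as
the pushout of `E → Q` and `E → Y`. -/
lemma IsExtension.exists_quotient {L E Y Q G : A} (h₁ : IsExtension L E Y)
    (h₂ : IsExtension E Q G) : ∃ D : A, IsExtension Y D G ∧ IsExtension L Q D := by
  obtain ⟨l, e, w, hS⟩ := h₁
  obtain ⟨j, q, w', hT⟩ := h₂
  have : Mono l := hS.mono_f
  have : Epi e := hS.epi_g
  have : Mono j := hT.mono_f
  refine ⟨pushout j e, isExtension_of_isPushout hT (IsPushout.of_hasPushout j e),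
    l ≫ j, pushout.inl j e, ?_, .mk' ?_ ?_ ?_⟩
  · rw [Category.assoc, pushout.condition, reassoc_of% w, zero_comp]
  · refine ShortComplex.exact_of_g_is_cokernel _ (CokernelCofork.IsColimit.ofπ' _ _ ?_)
    intro T s hs
    dsimp at s hs ⊢
    have hs' : l ≫ j ≫ s = 0 := by simpa using hs
    exact ⟨pushout.desc s (hS.exact.desc (j ≫ s) hs') (hS.exact.g_desc _ _).symm,
      pushout.inl_desc _ _ _⟩
  · dsimp; infer_instance
  · dsimp; infer_instance

/-- One step of the horseshoe construction. -/
lemma IsExtension.exists_horseshoe [EnoughProjectives A] {X J Z K P : A}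
    (h₁ : IsExtension X J Z) (h₂ : IsExtension K P X) (hP : Projective P) :
    ∃ K₂ P₂ K₃ P₃ : A, Projective P₂ ∧ Projective P₃ ∧ IsExtension K₂ P₂ J ∧
      IsExtension K₃ P₃ Z ∧ IsExtension K K₂ K₃ := by
  obtain ⟨ι, π, w, hS⟩ := h₁
  obtain ⟨i, p, w', hT⟩ := h₂
  have : Mono ι := hS.mono_f
  have : Epi π := hS.epi_g
  have : Mono i := hT.mono_f
  have : Epi p := hT.epi_g
  let q := Projective.π J
  -- The summand covering `J` also covers `Z` through `π`, so no separate cover of `Z` has to be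
  -- lifted.
  let m : P ⊞ Projective.over J ⟶ J := biprod.desc (p ≫ ι) q
  have : Epi m := by
    have h : biprod.inr ≫ m = q := by simp [m]
    have : Epi (biprod.inr ≫ m) := by rw [h]; infer_instance
    exact epi_of_epi (biprod.inr) m
  refine ⟨kernel m, _, kernel (q ≫ π), _, inferInstance, inferInstance,
    isExtension_of_epi m, isExtension_of_epi (q ≫ π),
    kernel.lift m (i ≫ biprod.inl) (by simp [m, reassoc_of% w']),
    kernel.lift (q ≫ π) (kernel.ι m ≫ biprod.snd) ?_, ?_, .mk' ?_ ?_ ?_⟩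
  · have h : biprod.snd ≫ q ≫ π = m ≫ π := by
      ext <;> simp [m, w]
    simp [h]
  · ext; simp
  · rw [ShortComplex.exact_iff_exact_up_to_refinements]
    intro T x hx
    dsimp at x hx ⊢
    have h₁ : (x ≫ kernel.ι m) ≫ biprod.snd = 0 := by
      simpa using hx =≫ kernel.ι (q ≫ π)
    have h₂ : (x ≫ kernel.ι m) ≫ biprod.fst ≫ p = 0 := by
      have h : m = biprod.fst ≫ p ≫ ι + biprod.snd ≫ q := by ext <;> simp [m]
      have h' : x ≫ kernel.ι m ≫ (biprod.fst ≫ p ≫ ι + biprod.snd ≫ q) = 0 := by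
        rw [← h, kernel.condition, comp_zero]
      rw [← cancel_mono ι]
      simp only [Preadditive.comp_add] at h'
      simp only [Category.assoc] at h₁ ⊢
      simpa [reassoc_of% h₁] using h'
    refine ⟨T, 𝟙 T, inferInstance, hT.exact.lift ((x ≫ kernel.ι m) ≫ biprod.fst)
      (by simpa using h₂), ?_⟩
    have hl := hT.exact.lift_f ((x ≫ kernel.ι m) ≫ biprod.fst) (by simpa using h₂)
    dsimp at hl
    ext
    · simp [reassoc_of% hl]
    · simp at h₁
      simp [h₁]
  · dsimp
    have h : Mono (kernel.lift m (i ≫ biprod.inl) (by simp [m, reassoc_of% w']) ≫ kernel.ι m) := by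
      rw [kernel.lift_ι]; infer_instance
    exact mono_of_mono _ (kernel.ι m)
  · rw [epi_iff_surjective_up_to_refinements]
    intro T y
    dsimp at y ⊢
    have hy : (y ≫ kernel.ι (q ≫ π) ≫ q) ≫ π = 0 := by simp
    have hb := hS.exact.lift_f _ hy
    obtain ⟨T', τ, hτ, c, hc⟩ := surjective_up_to_refinements_of_epi p (hS.exact.lift _ hy)
    dsimp at hb hc
    -- The image of `y` in `J` comes from `X`, and `c` lifts it to `P`; the sign makes the two
    -- contributions to `m` cancel.
    refine ⟨T', τ, hτ, kernel.lift m (biprod.lift (-c) (τ ≫ y ≫ kernel.ι (q ≫ π))) ?_, ?_⟩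
    · simp [m, ← reassoc_of% hc, hb]
    · ext; simp

/-- If an extension `E` of `G` by `P` splits, then an embedding of `G` into `Q` induces an
embedding of `E` into `P ⊞ Q` with the same cokernel. -/
lemma IsExtension.exists_biprod {P E G Q Z : A} (h₁ : IsExtension P E G)
    (h₂ : IsExtension G Q Z) (hr : ∀ f : P ⟶ E, ∀ g : E ⟶ G, ∀ w : f ≫ g = 0,
      (ShortComplex.mk f g w).ShortExact → ∃ r : E ⟶ P, f ≫ r = 𝟙 P) :
    IsExtension E (P ⊞ Q) Z := by
  obtain ⟨f, g, w, hS⟩ := h₁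
  obtain ⟨j, q, w', hT⟩ := h₂
  obtain ⟨r, hfr⟩ := hr f g w hS
  have : Mono f := hS.mono_f
  have : Epi g := hS.epi_g
  have : Mono j := hT.mono_f
  have : Epi q := hT.epi_g
  refine ⟨biprod.lift r (g ≫ j), biprod.snd ≫ q, by simp [w'], .mk' ?_ ?_ ?_⟩
  · rw [ShortComplex.exact_iff_exact_up_to_refinements]
    intro T x hx
    dsimp at x hx ⊢
    have hb := hT.exact.lift_f (x ≫ biprod.snd) (by simpa using hx)
    obtain ⟨T', τ, hτ, c, hc⟩ := surjective_up_to_refinements_of_epi g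
      (hT.exact.lift (x ≫ biprod.snd) (by simpa using hx))
    dsimp at hb hc
    -- A lift `c` matches only the `Q`-coordinate; adding a multiple of `f` corrects the
    -- `P`-coordinate without changing the other.
    refine ⟨T', τ, hτ, c + (τ ≫ x ≫ biprod.fst - c ≫ r) ≫ f, ?_⟩
    ext
    · simp [hfr]
    · simp [reassoc_of% w, ← reassoc_of% hc, hb]
  · dsimp
    rw [Preadditive.mono_iff_cancel_zero]
    intro T x hx
    have h₁ : x ≫ r = 0 := by simpa using hx =≫ biprod.fst
    have h₂ : x ≫ g = 0 := by
      rw [← cancel_mono j]; simpa using hx =≫ biprod.snd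
    have hl := hS.exact.lift_f x h₂
    dsimp at hl
    rw [← hl, Category.assoc, hfr, Category.comp_id] at h₁
    rw [← hl, h₁, zero_comp]
  · dsimp; infer_instance

/-! ### Vanishing of Ext, extension of morphisms and splitting -/

section Ext

variable [HasExt.{w} A]

lemma IsExtension.ext_left {X Y Z T : A} (h : IsExtension X Y Z) (i : ℕ)
    (hY : Subsingleton (Ext.{w} Y T i)) (hZ : Subsingleton (Ext.{w} Z T (i + 1))) :
    Subsingleton (Ext.{w} X T i) := by
  obtain ⟨f, g, w, hS⟩ := h
  refine subsingleton_of_forall_eq 0 fun x ↦ ?_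
  obtain ⟨y, rfl⟩ := Ext.contravariant_sequence_exact₁ hS _ x (add_comm 1 i)
    (Subsingleton.elim _ _)
  rw [Subsingleton.elim (α := Ext.{w} Y T i) y 0, Ext.comp_zero]

lemma IsExtension.ext_middle {X Y Z T : A} (h : IsExtension X Y Z) (i : ℕ)
    (hX : Subsingleton (Ext.{w} X T i)) (hZ : Subsingleton (Ext.{w} Z T i)) :
    Subsingleton (Ext.{w} Y T i) := by
  obtain ⟨f, g, w, hS⟩ := h
  refine subsingleton_of_forall_eq 0 fun x ↦ ?_
  obtain ⟨y, rfl⟩ := Ext.contravariant_sequence_exact₂ hS _ x (Subsingleton.elim _ _)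
  rw [Subsingleton.elim (α := Ext.{w} Z T i) y 0, Ext.comp_zero]

lemma exists_extend_of_ext {X Y Z T : A} {f : X ⟶ Y} {g : Y ⟶ Z} {w : f ≫ g = 0}
    (hS : (ShortComplex.mk f g w).ShortExact) (hZ : Subsingleton (Ext.{w} Z T 1)) (φ : X ⟶ T) :
    ∃ ψ : Y ⟶ T, f ≫ ψ = φ := by
  obtain ⟨y, hy⟩ := Ext.contravariant_sequence_exact₁ hS _ (Ext.mk₀ φ) (add_zero 1)
    (Subsingleton.elim _ _)
  obtain ⟨ψ, rfl⟩ := Ext.homEquiv₀.symm.surjective y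
  refine ⟨ψ, Ext.homEquiv₀.{w}.symm.injective ?_⟩
  simpa using hy

lemma ext_subsingleton_of_iso {X X' T : A} (e : X ≅ X') (i : ℕ)
    (h : Subsingleton (Ext.{w} X' T i)) : Subsingleton (Ext.{w} X T i) := by
  refine subsingleton_of_forall_eq 0 fun x ↦ ?_
  have : (Ext.mk₀ e.hom).comp ((Ext.mk₀ e.inv).comp x (zero_add i)) (zero_add i) = x := by
    simp
  rw [← this, Subsingleton.elim ((Ext.mk₀ e.inv).comp x (zero_add i)) 0, Ext.comp_zero]

lemma IsExtension.retract_right {X Y Z : A} (h : IsExtension X Y Z)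
    (hZ : Subsingleton (Ext.{w} Z X 1)) : Nonempty (Retract X Y) ∧ Nonempty (Retract Z Y) := by
  obtain ⟨f, g, w, hS⟩ := h
  obtain ⟨r, hr⟩ := exists_extend_of_ext hS hZ (𝟙 X)
  have s := ShortComplex.Splitting.ofExactOfRetraction _ hS.exact r hr hS.epi_g
  exact ⟨⟨⟨f, r, hr⟩⟩, ⟨⟨s.s, g, s.s_g⟩⟩⟩

end Ext

/-! ### Syzygies and dimension shifting -/

section Syzygy

lemma isSyzygyOf_succ_iff {n : ℕ} {X C : A} :
    IsSyzygyOf (n + 1) X C ↔ ∃ K P : A, IsExtension K P X ∧ Projective P ∧ IsSyzygyOf n K C := by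
  constructor
  · rintro ⟨K, P, i, p, h, hS, hP, hK⟩
    exact ⟨K, P, ⟨i, p, h, hS⟩, hP, hK⟩
  · rintro ⟨K, P, ⟨i, p, h, hS⟩, hP, hK⟩
    exact ⟨K, P, i, p, h, hS, hP, hK⟩

lemma IsSyzygyOf.of_iso {n : ℕ} {X C C' : A} (e : C' ≅ C) (h : IsSyzygyOf n X C) :
    IsSyzygyOf n X C' := by
  induction n generalizing X with
  | zero => exact ⟨e ≪≫ h.some⟩
  | succ n ih =>
    obtain ⟨K, P, hE, hP, hK⟩ := isSyzygyOf_succ_iff.1 h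
    exact isSyzygyOf_succ_iff.2 ⟨K, P, hE, hP, ih hK⟩

lemma exists_isSyzygyOf [EnoughProjectives A] (n : ℕ) (X : A) : ∃ C : A, IsSyzygyOf n X C := by
  induction n generalizing X with
  | zero => exact ⟨X, ⟨Iso.refl X⟩⟩
  | succ n ih =>
    obtain ⟨K, P, hP, hE⟩ := exists_isExtension_of_enoughProjectives X
    obtain ⟨C, hC⟩ := ih K
    exact ⟨C, isSyzygyOf_succ_iff.2 ⟨K, P, hE, hP, hC⟩⟩

lemma IsSyzygyOf.exists_horseshoe [EnoughProjectives A] {n : ℕ} {X J Z C : A}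
    (h : IsExtension X J Z) (hC : IsSyzygyOf n X C) :
    ∃ C₂ C₃ : A, IsSyzygyOf n J C₂ ∧ IsSyzygyOf n Z C₃ ∧ IsExtension C C₂ C₃ := by
  induction n generalizing X J Z with
  | zero => exact ⟨J, Z, ⟨Iso.refl _⟩, ⟨Iso.refl _⟩, isExtension_of_iso_left hC.some h⟩
  | succ n ih =>
    obtain ⟨K, P, hE, hP, hK⟩ := isSyzygyOf_succ_iff.1 hC
    obtain ⟨K₂, P₂, K₃, P₃, hP₂, hP₃, h₂, h₃, hK'⟩ := h.exists_horseshoe hE hP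
    obtain ⟨C₂, C₃, hC₂, hC₃, hC'⟩ := ih hK' hK
    exact ⟨C₂, C₃, isSyzygyOf_succ_iff.2 ⟨_, _, h₂, hP₂, hC₂⟩,
      isSyzygyOf_succ_iff.2 ⟨_, _, h₃, hP₃, hC₃⟩, hC'⟩

lemma IsSyzygyOf.projective {n : ℕ} {X C : A} (hC : IsSyzygyOf n X C)
    (hX : HasProjectiveDimensionLT X (n + 1)) : Projective C := by
  induction n generalizing X with
  | zero =>
    rw [projective_iff_hasProjectiveDimensionLT_one]
    exact hasProjectiveDimensionLT_of_iso hC.some.symm 1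
  | succ n ih =>
    obtain ⟨K, P, ⟨i, p, h, hS⟩, hP, hK⟩ := isSyzygyOf_succ_iff.1 hC
    exact ih hK ((hS.hasProjectiveDimensionLT_X₃_iff n hP).1 hX)

/-- The degree is written `i + 1` to keep it positive, where the projective terms contribute
nothing. -/
lemma IsSyzygyOf.ext_subsingleton [HasExt.{w} A] {n : ℕ} {X C T : A} (hC : IsSyzygyOf n X C)
    (i : ℕ) (h : Subsingleton (Ext.{w} X T (i + 1 + n))) :
    Subsingleton (Ext.{w} C T (i + 1)) := by
  induction n generalizing X with
  | zero => exact ext_subsingleton_of_iso hC.some _ h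
  | succ n ih =>
    obtain ⟨K, P, hE, hP, hK⟩ := isSyzygyOf_succ_iff.1 hC
    refine ih hK (hE.ext_left _ ?_ h)
    exact HasProjectiveDimensionLT.subsingleton P 1 _ (by lia) T

end Syzygy

/-! ### Complete projective resolutions -/

section CompleteResolution

/-- A sequence indexed by `ℤ` obtained from two sequences indexed by `ℕ`. -/
def glueSeq {α : Type*} (a b : ℕ → α) : ℤ → α
  | Int.ofNat k => a k
  -- `Int.negSucc k` is `-(k + 1)`; the value `b 0` is dropped and must agree with `a 0`.
  | Int.negSucc k => b (k + 1)

lemma glueSeq_rel {α : Type*} {r : α → α → Prop} {a b : ℕ → α} (h₀ : a 0 = b 0)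
    (ha : ∀ k, r (a k) (a (k + 1))) (hb : ∀ k, r (b (k + 1)) (b k)) (i : ℤ) :
    r (glueSeq a b i) (glueSeq a b (i + 1)) := by
  match i with
  | Int.ofNat k => exact ha k
  | Int.negSucc 0 =>
    have h : r (b 1) (a 0) := by rw [h₀]; exact hb 0
    exact h
  | Int.negSucc (k + 1) => exact hb (k + 1)

lemma exists_int_seq {α : Type*} {r : α → α → Prop} (hl : ∀ x, ∃ y, r y x) (hr : ∀ x, ∃ y, r x y)
    (x : α) : ∃ z : ℤ → α, z 0 = x ∧ ∀ i, r (z i) (z (i + 1)) := by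
  choose l hl using hl
  choose f hf using hr
  exact ⟨glueSeq (fun k ↦ f^[k] x) (fun k ↦ l^[k] x), rfl,
    glueSeq_rel rfl (fun k ↦ by rw [Function.iterate_succ_apply']; exact hf _)
      (fun k ↦ by rw [Function.iterate_succ_apply']; exact hl _)⟩

/-- The sequences are spliced into one complex. A map to `Q` killed by the incoming differential
descends to the next `Z`, then extends to the next `P` because Ext from the following `Z` to `Q`
vanishes. -/
lemma gorensteinProjective_of_seq [HasExt.{w} A] (Z P : ℤ → A) (hP : ∀ i, Projective (P i))
    (hZ : ∀ i, IsExtension (Z i) (P i) (Z (i + 1)))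
    (hext : ∀ i, ∀ Q : A, Projective Q → Subsingleton (Ext.{w} (Z i) Q 1)) :
    gorensteinProjective A (Z 0) := by
  choose ι p w hS using hZ
  have hι (i) : Mono (ι i) := (hS i).mono_f
  have hp (i) : Epi (p i) := (hS i).epi_g
  let d (i : ℤ) : P i ⟶ P (i + 1) := p i ≫ ι (i + 1)
  have hd (i : ℤ) : d i ≫ d (i + 1) = 0 := by
    simp only [d, Category.assoc, reassoc_of% (w (i + 1)), zero_comp, comp_zero]
  let K : CochainComplex A ℤ := CochainComplex.of P d hd
  have hK (i : ℤ) : K.d i (i + 1) = d i := CochainComplex.of_d P d i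
  have lift {i : ℤ} {T : A} (f : P (i + 1) ⟶ T) (hf : d i ≫ f = 0) : ι (i + 1) ≫ f = 0 := by
    rw [← cancel_epi (p i), comp_zero, ← hf, Category.assoc]
  refine ⟨K, hP, fun j ↦ ?_, ?_, ?_⟩
  · obtain ⟨i, rfl⟩ : ∃ i, j = i + 1 := ⟨j - 1, by ring⟩
    rw [K.exactAt_iff' i (i + 1) (i + 1 + 1) (by simp) (by simp)]
    have : (ShortComplex.mk (d i) (d (i + 1)) (hd i)).Exact := by
      rw [ShortComplex.exact_iff_exact_up_to_refinements]
      intro T x hx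
      dsimp at x hx ⊢
      have hx' : x ≫ p (i + 1) = 0 := by
        rw [← cancel_mono (ι (i + 1 + 1)), zero_comp, Category.assoc]; exact hx
      obtain ⟨T', τ, hτ, c, hc⟩ :=
        surjective_up_to_refinements_of_epi (p i) ((hS (i + 1)).exact.lift x hx')
      have hl := (hS (i + 1)).exact.lift_f x hx'
      dsimp at hl hc
      refine ⟨T', τ, hτ, c, ?_⟩
      simp only [d, ← reassoc_of% hc, hl]
    convert this using 1
    simp only [HomologicalComplex.shortComplexFunctor', HomologicalComplex.sc']
    congr 1
    · exact hK i
    · exact hK (i + 1)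
  · intro Q hQ i f hf
    rw [hK] at hf
    have hf' := lift f hf
    obtain ⟨ψ, hψ⟩ := exists_extend_of_ext (hS (i + 1 + 1)) (hext _ Q hQ)
      ((hS (i + 1)).exact.desc f hf')
    refine ⟨ψ, ?_⟩
    rw [hK]
    have := (hS (i + 1)).exact.g_desc f hf'
    dsimp at this
    simp only [d, Category.assoc, hψ, this]
  · have h0 : K.d 0 1 = p 0 ≫ ι 1 := hK 0
    have hw : ι 0 ≫ K.d 0 1 = 0 := by rw [h0, reassoc_of% (w 0), zero_comp]
    have hlim : IsLimit (KernelFork.ofι (ι 0) hw) := by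
      refine KernelFork.IsLimit.ofι' _ _ fun {T} k hk ↦ ?_
      have hk' : k ≫ p 0 = 0 := by
        rw [← cancel_mono (ι (0 + 1)), zero_comp, Category.assoc]
        exact (congrArg (k ≫ ·) h0.symm).trans hk
      exact ⟨(hS 0).exact.lift k hk', (hS 0).exact.lift_f k hk'⟩
    exact ⟨hlim.conePointUniqueUpToIso (limit.isLimit _)⟩

lemma gorensteinProjective_of_closed [HasExt.{w} A] (F : ObjectProperty A)
    (hl : ∀ X, F X → ∃ K P : A, Projective P ∧ F K ∧ IsExtension K P X)
    (hr : ∀ X, F X → ∃ P Z : A, Projective P ∧ F Z ∧ IsExtension X P Z)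
    (hext : ∀ X Q : A, F X → Projective Q → Subsingleton (Ext.{w} X Q 1)) {C : A} (hC : F C) :
    gorensteinProjective A C := by
  obtain ⟨z, hz₀, hz⟩ := exists_int_seq (α := {X : A // F X})
    (r := fun X Y ↦ ∃ P : A, Projective P ∧ IsExtension X.1 P Y.1)
    (fun X ↦ let ⟨K, P, hP, hK, h⟩ := hl X.1 X.2; ⟨⟨K, hK⟩, P, hP, h⟩)
    (fun X ↦ let ⟨P, Z, hP, hZ, h⟩ := hr X.1 X.2; ⟨⟨Z, hZ⟩, P, hP, h⟩) ⟨C, hC⟩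
  choose P hP h using hz
  have := gorensteinProjective_of_seq (fun i ↦ (z i).1) P hP h fun i Q hQ ↦ hext _ Q (z i).2 hQ
  rwa [hz₀] at this

lemma isExtension_kernel_of_exactAt (K : CochainComplex A ℤ) (i : ℤ)
    (h : K.ExactAt (i + 1)) :
    IsExtension (kernel (K.d i (i + 1))) (K.X i) (kernel (K.d (i + 1) (i + 1 + 1))) := by
  rw [K.exactAt_iff' i (i + 1) (i + 1 + 1) (by simp) (by simp)] at h
  refine ⟨kernel.ι _, kernel.lift _ (K.d i (i + 1)) (K.d_comp_d _ _ _), by ext; simp,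
    .mk' ?_ ?_ ?_⟩
  · refine ShortComplex.exact_of_f_is_kernel _ (KernelFork.IsLimit.ofι' _ _ fun {T} k hk ↦ ?_)
    exact ⟨kernel.lift _ k (by simpa using hk =≫ kernel.ι _), kernel.lift_ι _ _ _⟩
  · dsimp; infer_instance
  · exact (ShortComplex.exact_iff_epi_kernel_lift _).1 h

lemma isSyzygyOf_kernel (K : CochainComplex A ℤ) (hK : K.Acyclic)
    (hP : ∀ i, Projective (K.X i)) (n : ℕ) (i j : ℤ) (h : j = i + n) :
    IsSyzygyOf n (kernel (K.d j (j + 1))) (kernel (K.d i (i + 1))) := by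
  induction n generalizing j with
  | zero =>
    obtain rfl : j = i := by simpa using h
    exact ⟨Iso.refl _⟩
  | succ n ih =>
    obtain rfl : j = i + n + 1 := by rw [h]; push_cast; ring
    exact isSyzygyOf_succ_iff.2 ⟨_, _, isExtension_kernel_of_exactAt K _ (hK _), hP _, ih _ rfl⟩

lemma isSyzygy_of_gorensteinProjective {C : A} (hC : gorensteinProjective A C) (n : ℕ) :
    IsSyzygy n C := by
  obtain ⟨K, hK⟩ := hC
  exact ⟨_, (isSyzygyOf_kernel K hK.exact hK.projective n 0 _ rfl).of_iso hK.kernel_iso.some⟩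

end CompleteResolution

/-! ### Objects of finite projective dimension -/

lemma finiteProjDim_iff_exists {X : A} :
    finiteProjDim A X ↔ ∃ k : ℕ, HasProjectiveDimensionLT X k := by
  rw [finiteProjDim, lt_top_iff_ne_top, projectiveDimension_ne_top_iff]
  constructor
  · rintro ⟨k, hk⟩
    exact ⟨k + 1, hk⟩
  · rintro ⟨k, hk⟩
    exact ⟨k, hasProjectiveDimensionLT_of_ge X k (k + 1) (by lia)⟩

lemma finiteProjDim_of_projective (P : A) [Projective P] : finiteProjDim A P :=
  finiteProjDim_iff_exists.2 ⟨1, inferInstance⟩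

lemma finiteInjDim_of_injective (I : A) [Injective I] : finiteInjDim A I :=
  lt_of_lt_of_le (injectiveDimension_lt_iff (n := 1).2 inferInstance) le_top

lemma IsExtension.finiteProjDim_right {X Y Z : A} (h : IsExtension X Y Z)
    (hX : finiteProjDim A X) (hY : finiteProjDim A Y) : finiteProjDim A Z := by
  obtain ⟨f, g, w, hS⟩ := h
  obtain ⟨k, hk⟩ := finiteProjDim_iff_exists.1 hX
  obtain ⟨l, hl⟩ := finiteProjDim_iff_exists.1 hY
  exact finiteProjDim_iff_exists.2 ⟨max k l + 1, hS.hasProjectiveDimensionLT_X₃ _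
    (hasProjectiveDimensionLT_of_ge _ k _ (by simp))
    (hasProjectiveDimensionLT_of_ge _ l _ (by lia))⟩

lemma IsExtension.finiteProjDim_left {X Y Z : A} (h : IsExtension X Y Z)
    (hY : finiteProjDim A Y) (hZ : finiteProjDim A Z) : finiteProjDim A X := by
  obtain ⟨f, g, w, hS⟩ := h
  obtain ⟨k, hk⟩ := finiteProjDim_iff_exists.1 hY
  obtain ⟨l, hl⟩ := finiteProjDim_iff_exists.1 hZ
  exact finiteProjDim_iff_exists.2 ⟨max k l, hS.hasProjectiveDimensionLT_X₁ _
    (hasProjectiveDimensionLT_of_ge _ k _ (by simp))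
    (hasProjectiveDimensionLT_of_ge _ l _ (by lia))⟩

lemma finiteProjDim_of_retract {X Y : A} (h : Retract X Y) (hY : finiteProjDim A Y) :
    finiteProjDim A X :=
  lt_of_le_of_lt h.projectiveDimension_le hY

/-- The kernel of a projective cover of `L` again has finite projective dimension, so the cover
splits. -/
lemma projective_of_leftPerp [HasExt.{w} A] [EnoughProjectives A] {L : A}
    (hL : finiteProjDim A L) (hL' : leftPerp.{w} (finiteProjDim A) L) : Projective L := by
  obtain ⟨K, P, hP, h⟩ := exists_isExtension_of_enoughProjectives L
  have hK := h.finiteProjDim_left (finiteProjDim_of_projective P) hL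
  exact (h.retract_right (hL' K hK)).2.some.projective

/-! ### Approximations and the cotorsion pair in a Gorenstein category -/

namespace IsGorensteinOfDimLE

variable {n : ℕ} (hA : IsGorensteinOfDimLE A n)

include hA

lemma hasProjectiveDimensionLT {X : A} (hX : finiteProjDim A X) :
    HasProjectiveDimensionLT X (n + 1) :=
  (projectiveDimension_le_iff X n).1
    ((le_iSup₂ (f := fun (X : A) (_ : finiteProjDim A X) ↦ projectiveDimension X) X hX).trans
      hA.FPD_le)

lemma hasInjectiveDimensionLT {X : A} (hX : finiteProjDim A X) :
    HasInjectiveDimensionLT X (n + 1) :=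
  (injectiveDimension_le_iff X n).1
    ((le_iSup₂ (f := fun (X : A) (_ : finiteInjDim A X) ↦ injectiveDimension X) X
      ((hA.finiteProjDim_iff X).1 hX)).trans hA.FID_le)

lemma finiteProjDim_of_injective (I : A) [Injective I] : finiteProjDim A I :=
  (hA.finiteProjDim_iff I).2 (finiteInjDim_of_injective I)

lemma ext_subsingleton_of_isSyzygy [HasExt.{w} A] {C L : A} (hC : IsSyzygy n C)
    (hL : finiteProjDim A L) (i : ℕ) : Subsingleton (Ext.{w} C L (i + 1)) := by
  obtain ⟨X, hX⟩ := hC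
  have := hA.hasInjectiveDimensionLT hL
  exact hX.ext_subsingleton i (HasInjectiveDimensionLT.subsingleton L (n + 1) _ (by lia) X)

lemma exists_projective_embedding [EnoughProjectives A] [EnoughInjectives A] {C : A}
    (hC : IsSyzygy n C) : ∃ P Z : A, Projective P ∧ IsSyzygy n Z ∧ IsExtension C P Z := by
  obtain ⟨X, hX⟩ := hC
  obtain ⟨I, X', hI, hE⟩ := exists_isExtension_of_enoughInjectives X
  obtain ⟨P, Z, hP, hZ, h⟩ := hX.exists_horseshoe hE
  exact ⟨P, Z, hP.projective (hA.hasProjectiveDimensionLT (hA.finiteProjDim_of_injective I)),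
    ⟨X', hZ⟩, h⟩

/-- Only the depth `k` varies in the induction; `C` stays a fixed `n`-th syzygy. An approximation `K
→ L → G` of the first syzygy is pushed out along `K → P`. The resulting extension of `G` by `P`
splits, so its middle term `E` embeds in a projective with syzygy cokernel; dividing by `L`
approximates `Y`. -/
lemma exists_right_approximation_of_isSyzygyOf [HasExt.{w} A] [EnoughProjectives A]
    [EnoughInjectives A] (k : ℕ) {Y C : A} (hC : IsSyzygyOf k Y C) (hC' : IsSyzygy n C) :
    ∃ L G : A, finiteProjDim A L ∧ IsSyzygy n G ∧ IsExtension Y L G := by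
  induction k generalizing Y with
  | zero =>
    obtain ⟨P, Z, hP, hZ, h⟩ := hA.exists_projective_embedding hC'
    exact ⟨P, Z, finiteProjDim_of_projective P, hZ, isExtension_of_iso_left hC.some.symm h⟩
  | succ k ih =>
    obtain ⟨K, P, hE, hP, hK⟩ := isSyzygyOf_succ_iff.1 hC
    obtain ⟨L, G, hL, hG, h⟩ := ih hK
    obtain ⟨E, h₁, h₂⟩ := hE.exists_pushout h
    obtain ⟨Q, Z, hQ, hZ, h₃⟩ := hA.exists_projective_embedding hG
    have hr := h₂.exists_biprod h₃ fun f g w hS ↦ exists_extend_of_ext hS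
      (hA.ext_subsingleton_of_isSyzygy.{w} hG (finiteProjDim_of_projective P) 0) (𝟙 P)
    obtain ⟨D, h₄, h₅⟩ := h₁.exists_quotient hr
    exact ⟨D, Z, h₅.finiteProjDim_right hL (finiteProjDim_of_projective _), hZ, h₄⟩

lemma exists_right_approximation [HasExt.{w} A] [EnoughProjectives A] [EnoughInjectives A]
    (Y : A) : ∃ L G : A, finiteProjDim A L ∧ IsSyzygy n G ∧ IsExtension Y L G := by
  obtain ⟨C, hC⟩ := exists_isSyzygyOf n Y
  exact hA.exists_right_approximation_of_isSyzygyOf.{w} n hC ⟨Y, hC⟩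

/-- Salce's trick: a right approximation of the kernel of a projective cover is pushed out, and `E`
becomes an extension of a syzygy by a projective. -/
lemma exists_left_approximation [HasExt.{w} A] [EnoughProjectives A] [EnoughInjectives A]
    (Y : A) : ∃ L E : A, finiteProjDim A L ∧ leftPerp.{w} (finiteProjDim A) E ∧
      IsExtension L E Y := by
  obtain ⟨K, P, hP, h⟩ := exists_isExtension_of_enoughProjectives Y
  obtain ⟨L, G, hL, hG, h'⟩ := hA.exists_right_approximation.{w} K
  obtain ⟨E, h₁, h₂⟩ := h.exists_pushout h'
  exact ⟨L, E, hL, fun T hT ↦ h₂.ext_middle 1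
    (HasProjectiveDimensionLT.subsingleton P 1 1 le_rfl T)
    (hA.ext_subsingleton_of_isSyzygy hG hT 0), h₁⟩

lemma leftPerp_of_isSyzygy [HasExt.{w} A] {C : A} (hC : IsSyzygy n C) :
    leftPerp.{w} (finiteProjDim A) C :=
  fun _ hL ↦ hA.ext_subsingleton_of_isSyzygy hC hL 0

lemma exists_isSyzygyOf_of_leftPerp [HasExt.{w} A] [EnoughProjectives A] [EnoughInjectives A]
    {C : A} (hC : leftPerp.{w} (finiteProjDim A) C) (k : ℕ) :
    ∃ X : A, leftPerp.{w} (finiteProjDim A) X ∧ IsSyzygyOf k X C := by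
  induction k with
  | zero => exact ⟨C, hC, ⟨Iso.refl C⟩⟩
  | succ k ih =>
    obtain ⟨X, hX, hXC⟩ := ih
    obtain ⟨L, G, hL, hG, h⟩ := hA.exists_right_approximation.{w} X
    have hG' := hA.leftPerp_of_isSyzygy.{w} hG
    -- `L` is an extension of two objects of the left perpendicular class, which together with
    -- finite projective dimension makes it projective.
    have hL' : leftPerp.{w} (finiteProjDim A) L :=
      fun T hT ↦ h.ext_middle 1 (hX T hT) (hG' T hT)
    exact ⟨G, hG', isSyzygyOf_succ_iff.2 ⟨X, L, h, projective_of_leftPerp.{w} hL hL', hXC⟩⟩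

lemma isSyzygy_iff_leftPerp [HasExt.{w} A] [EnoughProjectives A] [EnoughInjectives A] {C : A} :
    IsSyzygy n C ↔ leftPerp.{w} (finiteProjDim A) C :=
  ⟨hA.leftPerp_of_isSyzygy, fun hC ↦
    let ⟨X, _, hX⟩ := hA.exists_isSyzygyOf_of_leftPerp hC n
    ⟨X, hX⟩⟩

/-- Vanishing of Ext² from `Z` is needed; it holds because `Z` is an `n`-th syzygy. -/
lemma leftPerp_left [HasExt.{w} A] [EnoughProjectives A] [EnoughInjectives A] {X Y Z : A}
    (h : IsExtension X Y Z) (hY : leftPerp.{w} (finiteProjDim A) Y)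
    (hZ : leftPerp.{w} (finiteProjDim A) Z) : leftPerp.{w} (finiteProjDim A) X :=
  fun T hT ↦ h.ext_left 1 (hY T hT)
    (hA.ext_subsingleton_of_isSyzygy (hA.isSyzygy_iff_leftPerp.2 hZ) hT 1)

lemma gorensteinProjective_of_isSyzygy [HasExt.{w} A] [EnoughProjectives A]
    [EnoughInjectives A] {C : A} (hC : IsSyzygy n C) : gorensteinProjective A C := by
  refine gorensteinProjective_of_closed.{w} (IsSyzygy n) (fun X hX ↦ ?_)
    (fun X hX ↦ hA.exists_projective_embedding hX)
    (fun X Q hX hQ ↦ hA.ext_subsingleton_of_isSyzygy hX (finiteProjDim_of_projective Q) 0) hC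
  obtain ⟨K, P, hP, h⟩ := exists_isExtension_of_enoughProjectives X
  refine ⟨K, P, hP, hA.isSyzygy_iff_leftPerp.{w}.2 (hA.leftPerp_left h ?_
    (hA.leftPerp_of_isSyzygy hX)), h⟩
  exact fun T _ ↦ HasProjectiveDimensionLT.subsingleton P 1 1 le_rfl T

lemma rightPerp_leftPerp [HasExt.{w} A] [EnoughProjectives A] [EnoughInjectives A] :
    rightPerp.{w} (leftPerp.{w} (finiteProjDim A)) = finiteProjDim A := by
  ext Y
  refine ⟨fun hY ↦ ?_, fun hY X hX ↦ hX Y hY⟩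
  obtain ⟨L, G, hL, hG, h⟩ := hA.exists_right_approximation.{w} Y
  -- The right approximation of `Y` splits, so `Y` is a retract of `L`.
  exact finiteProjDim_of_retract (h.retract_right (hY G (hA.leftPerp_of_isSyzygy hG))).1.some hL

lemma glGpd_le [HasExt.{w} A] [EnoughProjectives A] [EnoughInjectives A] : glGpd A ≤ n := by
  refine iSup_le fun X ↦ sInf_le ?_
  obtain ⟨C, hC⟩ := exists_isSyzygyOf n X
  exact ⟨n, rfl, C, hC, hA.gorensteinProjective_of_isSyzygy.{w} ⟨X, hC⟩⟩

end IsGorensteinOfDimLE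

end GorensteinCat

theorem mainTheorem3 (A : Type u) [Category.{v} A] [Abelian A] [IsGrothendieckAbelian.{w} A]
    [EnoughProjectives A] (n : ℕ) (hA : GorensteinCat.IsGorensteinOfDimLE A n) :
    (∀ C : A, List.TFAE
      [GorensteinCat.IsSyzygy n C,
       GorensteinCat.leftPerp.{w} (GorensteinCat.finiteProjDim A) C,
       GorensteinCat.gorensteinProjective A C]) ∧
    GorensteinCat.glGpd A ≤ n ∧
    GorensteinCat.IsCotorsionPair.{w}
      (GorensteinCat.leftPerp.{w} (GorensteinCat.finiteProjDim A))
      (GorensteinCat.finiteProjDim A) ∧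
    GorensteinCat.IsCompletePair
      (GorensteinCat.leftPerp.{w} (GorensteinCat.finiteProjDim A))
      (GorensteinCat.finiteProjDim A) ∧
    GorensteinCat.IsHereditaryPair.{w}
      (GorensteinCat.leftPerp.{w} (GorensteinCat.finiteProjDim A))
      (GorensteinCat.finiteProjDim A) := by
  refine ⟨fun C ↦ ?_, hA.glGpd_le.{w}, ⟨hA.rightPerp_leftPerp, rfl⟩, ⟨fun X ↦ ?_, fun Y ↦ ?_⟩,
    ⟨fun S hS h₂ h₃ ↦ hA.leftPerp_left ⟨_, _, _, hS⟩ h₂ h₃, fun S hS h₁ h₂ ↦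
      GorensteinCat.IsExtension.finiteProjDim_right ⟨_, _, _, hS⟩ h₁ h₂, fun F C hF hC i hi ↦ ?_⟩⟩
  · tfae_have 1 ↔ 2 := hA.isSyzygy_iff_leftPerp
    tfae_have 1 → 3 := hA.gorensteinProjective_of_isSyzygy.{w}
    tfae_have 3 → 1 := fun h ↦ GorensteinCat.isSyzygy_of_gorensteinProjective h n
    tfae_finish
  · obtain ⟨L, E, hL, hE, i, p, h, hS⟩ := hA.exists_left_approximation.{w} X
    exact ⟨L, E, i, p, h, hS, hE, hL⟩
  · obtain ⟨L, G, hL, hG, i, p, h, hS⟩ := hA.exists_right_approximation.{w} Y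
    exact ⟨L, G, i, p, h, hS, hA.leftPerp_of_isSyzygy hG, hL⟩
  · obtain ⟨j, rfl⟩ : ∃ j, i = j + 1 := ⟨i - 1, by lia⟩
    exact hA.ext_subsingleton_of_isSyzygy (hA.isSyzygy_iff_leftPerp.2 hF) hC j
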